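/- \textbf{Definitions.} Let $(\Omega,\mathcal A,\mathbb P)$ be a probability space. For $m\in\mathbb R$, a random variable $Y$ is $\mathrm{Gumbel}(m)$ distributed if $\mathbb P(Y\le t)=\exp(-\exp(-t+m))$ for all $t\in\mathbb R$; $Y\sim\mathrm{Gumbel}(-\infty)$ means $Y=-\infty$ almost surely. Put $\log 0=-\infty$. Let $P$ be a finite nonzero Borel measure on $\mathbb R^n$. A random function $G:\mathbb R^n\to\mathbb R\cup\{-\infty\}$ is a \emph{Gumbel process with measure $P$} if, almost surely, the maximum $\max_{x\in B}G(x)$ exists for every nonempty Borel set $B\subseteq\mathbb R^n$, and, with $G^*(B)=\max_{x\in B}G(x)$ (and $G^*(\emptyset)=-\infty$), (1) $G^*(B)\sim\mathrm{Gumbel}(\log P(B))$ for every Borel set $B$; (2) $G^*(A_1),\dots,G^*(A_m)$ are independent for all pairwise disjoint Borel sets $A_1,\dots,A_m$. \textbf{Lemma (Gumbel-Max trick).} Let $Q$ and $P$ be finite nonzero Borel measures on $\mathbb R^n$ with measurable densities $g,f:\mathbb R^n\to[0,\infty)$ with respect to some base measure $\mu$, that is, $Q(B)=\int_B g\,d\mu$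 and $P(B)=\int_B f\,d\mu$ for all Borel $B$. Write $\mathrm{supp}(g)=\{x: g(x)\neq 0\}$, and assume that $\mathrm{supp}(f)=\mathrm{supp}(g)$ and that there is a constant $M$ with $f(x)/g(x)\le M$ for all $x\in\mathrm{supp}(g)$. If $G:\mathbb R^n\to\mathbb R\cup\{-\infty\}$ is a Gumbel process with measure $Q$, then $$G'(x)=\begin{cases}\log f(x)-\log g(x)+G(x), & x\in\mathrm{supp}(g),\\ -\infty, & \text{otherwise,}\end{cases}$$ is a Gumbel process with measure $P$. In particular, $$\max_{x\in\mathbb R^n}G'(x)\sim\mathrm{Gumbel}(\log P(\mathbb R^n)),$$ and almost surely $G'$ has exactly one maximizer $X^*=\operatorname{argmax}_{x\in\mathbb R^n}G'(x)$, whose distribution is $P(\cdot)/P(\mathbb R^n)$. -/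

import Mathlib

open MeasureTheory ProbabilityTheory
open scoped NNReal ENNReal

/-- `IsGumbel X m Pr`: under `Pr`, the random variable `X` (with values in the extended reals) is
Gumbel distributed with location `m ∈ ℝ ∪ {-∞}`.  For real `m` the distribution function below
forces `X` to be real almost surely; `Gumbel(-∞)` is almost surely equal to `-∞`.
No random variable is Gumbel with location `+∞`. -/
def IsGumbel {Ω : Type*} [MeasurableSpace Ω] (X : Ω → EReal) (m : EReal) (Pr : Measure Ω) : Prop :=
  AEMeasurable X Pr ∧
    ((m = ⊥ ∧ ∀ᵐ ω ∂Pr, X ω = ⊥) ∨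
      ∃ a : ℝ, m = (a : EReal) ∧
        ∀ t : ℝ, Pr {ω | X ω ≤ (t : EReal)} = ENNReal.ofReal (Real.exp (-Real.exp (-t + a))))

/-- The value `max_{x ∈ B} G x`, as a supremum in the extended reals (it is `-∞` for `B = ∅`).
That the supremum is attained is part of the definition of a Gumbel process. -/
noncomputable def maxOver {E : Type*} (G : E → EReal) (B : Set E) : EReal := ⨆ x ∈ B, G x

/-- `IsGumbelProcess G P Pr`: the random function `G`, with values in `ℝ ∪ {-∞}`, on the
probability space `(Ω, Pr)` is a Gumbel process with measure `P`.  Here `P` is meant to be a finite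
nonzero measure, and subsets are Borel sets. -/
structure IsGumbelProcess {Ω : Type*} [MeasurableSpace Ω] {E : Type*} [MeasurableSpace E]
    (G : Ω → E → EReal) (P : Measure E) (Pr : Measure Ω) : Prop where
  /-- The values lie in `ℝ ∪ {-∞}`. -/
  ne_top : ∀ ω x, G ω x ≠ ⊤
  /-- Almost surely, the maximum of `G` over every nonempty measurable set exists. -/
  exists_max : ∀ᵐ ω ∂Pr, ∀ B : Set E, MeasurableSet B → B.Nonempty → ∃ x ∈ B, IsMaxOn (G ω) B x
  /-- The maximum over `B` is Gumbel distributed with location `log P(B)`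
  (where `log 0 = -∞`). -/
  isGumbel : ∀ B : Set E, MeasurableSet B →
    IsGumbel (fun ω => maxOver (G ω) B) (ENNReal.log (P B)) Pr
  /-- The maxima over finitely many disjoint sets are independent. -/
  indep : ∀ (m : ℕ) (A : Fin m → Set E), (∀ i, MeasurableSet (A i)) →
    (∀ i j, i ≠ j → Disjoint (A i) (A j)) → iIndepFun (fun i ω => maxOver (G ω) (A i)) Pr

open Classical in
/-- The perturbed function: `log f x - log g x + G x` where `g x ≠ 0`, and `-∞` elsewhere. -/
noncomputable def gumbelPerturb {E : Type*} (f g : E → ℝ≥0) (G : E → EReal) (x : E) : EReal :=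
  if x ∈ Function.support g then ((Real.log (f x) - Real.log (g x) : ℝ) : EReal) + G x else ⊥

/-! A Gumbel process behaves like the upper envelope of a Poisson process with intensity `Q ⊗ e⁻ᵗ
dt`, and adding `log r` multiplies that intensity by `r`. No Poisson process is constructed: its
void probabilities carry the argument. For measurable `φ : E → [0, ∞]`, the event that `φ x * exp (G
x) ≤ 1` for all `x` has probability `exp (-∫ φ dQ)` (`measure_forall_mul_exp_le_one`), and such a
formula conversely yields the Gumbel laws and the independence (`isGumbelProcess_of_measure`).
Replacing `G` by `log r + G` replaces `φ` by `φ r`, hence `Q` by `r Q`; here `r = f / g`.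

Existence of maxima is a separate matter. Almost surely only finitely many points exceed any real
level (`ae_finite_setOf_lt`), and bounded `r` preserves this.

For the argmax, the maxima over `B` and `Bᶜ` are independent, and `exp (-max)` is exponential with
rate `P B`, respectively `P Bᶜ`, when that rate is nonzero. The race between these clocks has no
ties and is won by `B` with probability `P B / P univ`. -/

/-- The function `a ↦ e⁻ᵃ` on `[0, ∞]`. -/
noncomputable def expNeg (a : ℝ≥0∞) : ℝ≥0∞ := EReal.exp (-(a : EReal))

@[simp] lemma expNeg_zero : expNeg 0 = 1 := by simp [expNeg]

@[simp] lemma expNeg_top : expNeg ⊤ = 0 := by simp [expNeg]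

lemma expNeg_add (a b : ℝ≥0∞) : expNeg (a + b) = expNeg a * expNeg b := by
  simp only [expNeg, EReal.exp_neg, EReal.coe_ennreal_add, EReal.exp_add]
  have h : ∀ c : ℝ≥0∞, EReal.exp (c : EReal) ≠ 0 := fun c => by
    rw [ne_eq, EReal.exp_eq_zero_iff]
    exact EReal.coe_ennreal_ne_bot c
  exact ENNReal.mul_inv (Or.inl (h a)) (Or.inr (h b))

lemma expNeg_sum {ι : Type*} (s : Finset ι) (a : ι → ℝ≥0∞) :
    expNeg (∑ i ∈ s, a i) = ∏ i ∈ s, expNeg (a i) := by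
  classical
  induction s using Finset.induction_on with
  | empty => simp
  | insert i s hi ih => rw [Finset.sum_insert hi, Finset.prod_insert hi, expNeg_add, ih]

lemma expNeg_of_ne_top {a : ℝ≥0∞} (ha : a ≠ ⊤) :
    expNeg a = ENNReal.ofReal (Real.exp (-a.toReal)) := by
  lift a to ℝ≥0 using ha
  have : ((a : ℝ≥0∞) : EReal) = ((a : ℝ) : EReal) := rfl
  rw [expNeg, this, ← EReal.coe_neg, EReal.exp_coe, ENNReal.coe_toReal]

lemma continuous_expNeg : Continuous expNeg :=
  ENNReal.continuous_exp.comp (continuous_neg.comp continuous_coe_ennreal_ereal)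

lemma one_sub_expNeg_le (a : ℝ≥0∞) : 1 - expNeg a ≤ a := by
  rcases eq_or_ne a ⊤ with rfl | ha
  · simp
  rw [expNeg_of_ne_top ha, ← ENNReal.ofReal_one, ← ENNReal.ofReal_sub _ (Real.exp_nonneg _)]
  refine ENNReal.ofReal_le_of_le_toReal ?_
  linarith [Real.add_one_le_exp (-a.toReal)]

/-- Lets `exp (-t)` encode a threshold `t`. With `0 * ⊤ = 0` it also covers infinite values: `t = ⊤`
is no constraint, `t = ⊥` forces `x = ⊥`. -/
lemma exp_neg_mul_exp_le_one_iff (t x : EReal) :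
    EReal.exp (-t) * EReal.exp x ≤ 1 ↔ x ≤ t := by
  rw [EReal.exp_neg, mul_comm, ← div_eq_mul_inv]
  rw [← EReal.exp_le_exp_iff]
  rcases eq_or_ne (EReal.exp t) ⊤ with h | h
  · simp [h]
  rcases eq_or_ne (EReal.exp t) 0 with h0 | h0
  · rw [h0]
    rcases eq_or_ne (EReal.exp x) 0 with h1 | h1
    · simp [h1]
    · simp [h1, ENNReal.div_zero h1]
  · rw [ENNReal.div_le_iff h0 h, one_mul]

lemma maxOver_le_iff {E : Type*} (G : E → EReal) (B : Set E) (t : EReal) :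
    maxOver G B ≤ t ↔ ∀ x ∈ B, G x ≤ t := by
  simp [maxOver]

lemma le_maxOver {E : Type*} {G : E → EReal} {B : Set E} {x : E} (hx : x ∈ B) :
    G x ≤ maxOver G B := le_biSup G hx

lemma maxOver_eq_of_isMaxOn {E : Type*} {F : E → EReal} {B : Set E} {x : E}
    (hx : IsMaxOn F B x) (hxB : x ∈ B) :
    maxOver F B = F x :=
  le_antisymm ((maxOver_le_iff F B _).2 fun _ hy => hx hy) (le_maxOver hxB)

/-! ### Gumbel laws and independence through distribution functions -/

section Gumbel

variable {Ω : Type*} [MeasurableSpace Ω] {Pr : Measure Ω} [IsProbabilityMeasure Pr]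

/-- One formula for both cases of the definition and for infinite `t`; `⊤ * 0 = 0` gives the right
value at `t = ⊥`, `p = 0`. -/
lemma IsGumbel.measure_le {X : Ω → EReal} {p : ℝ≥0∞}
    (h : IsGumbel X (ENNReal.log p) Pr) (t : EReal) :
    Pr {ω | X ω ≤ t} = expNeg (EReal.exp (-t) * p) := by
  have hlog {a : ℝ} (ha : ENNReal.log p = a) : p = ENNReal.ofReal (Real.exp a) := by
    rw [← EReal.exp_coe, ← ha, ENNReal.exp_log]
  induction t with
  | top => simp
  | coe t =>
    rcases h.2 with ⟨h0, h⟩ | ⟨a, ha, h⟩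
    · rw [ENNReal.log_eq_bot_iff] at h0
      rw [h0, mul_zero, expNeg_zero, ← measure_univ (μ := Pr)]
      refine measure_congr (Filter.eventuallyEq_set.2 ?_)
      filter_upwards [h] with ω hω
      simp [hω]
    · rw [h t, hlog ha, ← EReal.coe_neg, EReal.exp_coe, ← ENNReal.ofReal_mul (Real.exp_nonneg _),
        ← Real.exp_add, expNeg_of_ne_top ENNReal.ofReal_ne_top,
        ENNReal.toReal_ofReal (Real.exp_nonneg _)]
  | bot =>
    rcases h.2 with ⟨h0, h⟩ | ⟨a, ha, h⟩
    · rw [ENNReal.log_eq_bot_iff] at h0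
      rw [h0, mul_zero, expNeg_zero, ← measure_univ (μ := Pr)]
      refine measure_congr (Filter.eventuallyEq_set.2 ?_)
      filter_upwards [h] with ω hω
      simp [hω]
    · have hp0 : p ≠ 0 := by simp [hlog ha, Real.exp_pos]
      rw [EReal.neg_bot, EReal.exp_top, ENNReal.top_mul hp0, expNeg_top]
      have hlim : Filter.Tendsto
          (fun n : ℕ => ENNReal.ofReal (Real.exp (-Real.exp (-(-n : ℝ) + a)))) Filter.atTop (nhds 0) := by
        rw [← ENNReal.ofReal_zero]
        refine ENNReal.tendsto_ofReal (Real.tendsto_exp_neg_atTop_nhds_zero.comp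
          (Real.tendsto_exp_atTop.comp ?_))
        simp only [neg_neg]
        exact Filter.tendsto_atTop_add_const_right _ _ tendsto_natCast_atTop_atTop
      refine le_antisymm (ge_of_tendsto' hlim fun n => ?_) zero_le
      rw [← h]
      exact measure_mono fun ω (hω : X ω ≤ ⊥) => hω.trans bot_le

lemma isGumbel_of_measure_le {X : Ω → EReal} {p : ℝ≥0∞} (hp : p ≠ ⊤) (hX : AEMeasurable X Pr)
    (h : ∀ t : EReal, Pr {ω | X ω ≤ t} = expNeg (EReal.exp (-t) * p)) :
    IsGumbel X (ENNReal.log p) Pr := by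
  refine ⟨hX, ?_⟩
  rcases eq_or_ne p 0 with rfl | h0
  · left
    refine ⟨by simp, ?_⟩
    -- For `p = 0` the threshold `⊥` alone gives `X = ⊥` almost surely.
    have := h ⊥
    simp only [mul_zero, expNeg_zero, le_bot_iff] at this
    rw [← prob_compl_eq_zero_iff₀] at this
    · exact this
    · exact hX.nullMeasurableSet_preimage (measurableSet_singleton ⊥)
  · right
    refine ⟨Real.log p.toReal, ENNReal.log_pos_real h0 hp, fun t => ?_⟩
    rw [h, expNeg_of_ne_top]
    · congr 2
      rw [ENNReal.toReal_mul, ← EReal.coe_neg, EReal.exp_coe,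
        ENNReal.toReal_ofReal (Real.exp_nonneg _), Real.exp_add, Real.exp_log]
      exact ENNReal.toReal_pos h0 hp
    · rw [← EReal.coe_neg, EReal.exp_coe]
      exact ENNReal.mul_ne_top ENNReal.ofReal_ne_top hp

omit [IsProbabilityMeasure Pr] in
lemma aemeasurable_of_nullMeasurableSet_le {X : Ω → EReal}
    (h : ∀ t : EReal, NullMeasurableSet {ω | X ω ≤ t} Pr) : AEMeasurable X Pr := by
  refine NullMeasurable.aemeasurable ?_
  have : Measurable[_, _] (fun ω : NullMeasurableSpace Ω Pr => X ω) := measurable_of_Iic h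
  exact this

/-- Independence is determined by the joint distribution function. -/
lemma iIndepFun_of_measure_le {ι : Type*} [Fintype ι] {X : ι → Ω → EReal}
    (hX : ∀ i, AEMeasurable (X i) Pr)
    (h : ∀ t : ι → EReal, Pr {ω | ∀ i, X i ω ≤ t i} = ∏ i, Pr {ω | X i ω ≤ t i}) :
    iIndepFun X Pr := by
  classical
  refine iIndepFun.congr (fun i => (hX i).ae_eq_mk.symm) ?_
  rw [iIndepFun_iff_iIndep]
  refine iIndepSets.iIndep (fun i => (hX i).measurable_mk.comap_le)
    (fun i => Set.preimage ((hX i).mk (X i)) '' Set.range Set.Iic)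
    (fun i => ?_) (fun i => ?_) ?_
  · exact isPiSystem_Iic.comap _
  · rw [← MeasurableSpace.comap_generateFrom]
    congr 1
    exact BorelSpace.measurable_eq.trans (borel_eq_generateFrom_Iic EReal)
  · rw [iIndepSets_iff]
    intro s f hf
    have hf' : ∀ i, ∃ t : EReal, i ∈ s → f i = {ω | (hX i).mk (X i) ω ≤ t} := by
      intro i
      by_cases hi : i ∈ s
      · obtain ⟨_, ⟨t, rfl⟩, ht⟩ := hf i hi
        exact ⟨t, fun _ => ht.symm⟩
      · exact ⟨0, fun h => absurd h hi⟩
    choose t ht using hf'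
    have hae : ∀ u : ι → EReal, Pr {ω | ∀ i, (hX i).mk (X i) ω ≤ u i}
        = ∏ i, Pr {ω | (hX i).mk (X i) ω ≤ u i} := by
      intro u
      have h1 : ∀ᵐ ω ∂Pr, ∀ i, X i ω = (hX i).mk (X i) ω :=
        ae_all_iff.2 fun i => (hX i).ae_eq_mk
      rw [← measure_congr (s := {ω | ∀ i, X i ω ≤ u i}), h u]
      · refine Finset.prod_congr rfl fun i _ =>
          measure_congr (Filter.eventuallyEq_set.2 ?_)
        filter_upwards [h1] with ω hω
        simp [hω i]
      · refine Filter.eventuallyEq_set.2 ?_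
        filter_upwards [h1] with ω hω
        simp [hω]
    -- Threshold `⊤` removes the indices outside `s`: their factors are 1.
    have key := hae (fun i => if i ∈ s then t i else ⊤)
    have e1 : (⋂ i ∈ s, f i) =
        {ω | ∀ i, (hX i).mk (X i) ω ≤ (if i ∈ s then t i else ⊤)} := by
      ext ω
      simp only [Set.mem_iInter, Set.mem_ofPred_eq]
      refine forall_congr' fun i => ?_
      by_cases hi : i ∈ s
      · simp [hi, ht i hi]
      · simp [hi]
    rw [e1, key, ← Finset.prod_subset (Finset.subset_univ s)]
    · refine Finset.prod_congr rfl fun i hi => ?_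
      rw [ht i hi]; simp [hi]
    · intro i _ hi
      simp [hi]

end Gumbel

/-! ### Void probabilities characterize Gumbel processes -/

section GumbelProcess

variable {Ω : Type*} [MeasurableSpace Ω] {Pr : Measure Ω} [IsProbabilityMeasure Pr]
  {E : Type*} [MeasurableSpace E]

/-- On the level set `φ = c` the condition bounds the maximum by `-log c`. Level sets are disjoint,
so independence turns the probability into a product of factors `exp (-c * Q (φ = c))`. -/
lemma IsGumbelProcess.measure_simpleFunc {G : Ω → E → EReal} {Q : Measure E}
    (hG : IsGumbelProcess G Q Pr) (φ : SimpleFunc E ℝ≥0∞) :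
    NullMeasurableSet {ω | ∀ x, φ x * EReal.exp (G ω x) ≤ 1} Pr ∧
      Pr {ω | ∀ x, φ x * EReal.exp (G ω x) ≤ 1} = expNeg (φ.lintegral Q) := by
  classical
  set e := φ.range.equivFin with he
  let c : Fin φ.range.card → ℝ≥0∞ := fun i => (e.symm i : ℝ≥0∞)
  have hc : Function.Injective c := Subtype.val_injective.comp e.symm.injective
  let A : Fin φ.range.card → Set E := fun i => φ ⁻¹' {c i}
  have hA : ∀ i, MeasurableSet (A i) := fun i => φ.measurableSet_fiber _
  have hset : {ω | ∀ x, φ x * EReal.exp (G ω x) ≤ 1} =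
      ⋂ i, {ω | maxOver (G ω) (A i) ≤ -ENNReal.log (c i)} := by
    ext ω
    simp only [Set.mem_ofPred_eq, Set.mem_iInter, maxOver_le_iff]
    simp only [← exp_neg_mul_exp_le_one_iff (-ENNReal.log _), neg_neg, ENNReal.exp_log]
    constructor
    · intro h i x hx
      have hx' : φ x = c i := hx
      rw [← hx']; exact h x
    · intro h x
      have hx : x ∈ A (e ⟨φ x, φ.mem_range_self x⟩) := by simp [A, c]
      simpa [c] using h _ x hx
  rw [hset]
  constructor
  · exact NullMeasurableSet.iInter fun i =>
      (hG.isGumbel _ (hA i)).1.nullMeasurableSet_preimage measurableSet_Iic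
  · have hind := hG.indep _ A hA fun i j hij => by
      refine Disjoint.preimage _ ?_
      simpa using fun h => hij (hc h)
    refine (hind.meas_iInter fun i =>
      ⟨Set.Iic (-ENNReal.log (c i)), measurableSet_Iic, rfl⟩).trans ?_
    change ∏ i, Pr {ω | maxOver (G ω) (A i) ≤ -ENNReal.log (c i)} = _
    simp_rw [(hG.isGumbel _ (hA _)).measure_le, neg_neg, ENNReal.exp_log]
    rw [← expNeg_sum, SimpleFunc.lintegral, ← Finset.sum_coe_sort φ.range,
      ← Equiv.sum_comp e.symm]

/-- The void probabilities of a Gumbel process, seen as a point process on the hypograph. -/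
theorem IsGumbelProcess.measure_forall_mul_exp_le_one {G : Ω → E → EReal} {Q : Measure E}
    (hG : IsGumbelProcess G Q Pr) {φ : E → ℝ≥0∞} (hφ : Measurable φ) :
    NullMeasurableSet {ω | ∀ x, φ x * EReal.exp (G ω x) ≤ 1} Pr ∧
      Pr {ω | ∀ x, φ x * EReal.exp (G ω x) ≤ 1} = expNeg (∫⁻ x, φ x ∂Q) := by
  -- As the simple functions increase to `φ`, these events decrease to the desired one. `expNeg` is
  -- continuous at `⊤` too, so an infinite integral is allowed.
  let s : ℕ → Set Ω := fun k => {ω | ∀ x, SimpleFunc.eapprox φ k x * EReal.exp (G ω x) ≤ 1}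
  have hset : {ω | ∀ x, φ x * EReal.exp (G ω x) ≤ 1} = ⋂ k, s k := by
    ext ω
    simp only [s, Set.mem_iInter, Set.mem_ofPred_eq]
    rw [forall_comm]
    refine forall_congr' fun x => ?_
    rw [← SimpleFunc.iSup_eapprox_apply hφ x, ENNReal.iSup_mul, iSup_le_iff]
  have hs : ∀ k, NullMeasurableSet (s k) Pr := fun k => (hG.measure_simpleFunc _).1
  have hanti : Antitone s := fun j k hjk ω hω x =>
    (mul_le_mul_left (SimpleFunc.monotone_eapprox φ hjk x) _).trans (hω x)
  rw [hset]
  refine ⟨NullMeasurableSet.iInter hs, ?_⟩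
  refine tendsto_nhds_unique
    (tendsto_measure_iInter_atTop hs hanti ⟨0, measure_ne_top _ _⟩) ?_
  have h1 : ∀ k, Pr (s k) = expNeg ((SimpleFunc.eapprox φ k).lintegral Q) :=
    fun k => (hG.measure_simpleFunc _).2
  simp_rw [Function.comp_def, h1]
  refine (continuous_expNeg.tendsto _).comp ?_
  rw [lintegral_eq_iSup_eapprox_lintegral hφ]
  exact tendsto_atTop_iSup fun j k hjk =>
    SimpleFunc.lintegral_mono (SimpleFunc.monotone_eapprox φ hjk) le_rfl

/-- A random function with the void probabilities of a Gumbel process is a Gumbel process, as soon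
as its maxima exist. -/
theorem isGumbelProcess_of_measure {H : Ω → E → EReal} {P : Measure E} [IsFiniteMeasure P]
    (ne_top : ∀ ω x, H ω x ≠ ⊤)
    (exists_max : ∀ᵐ ω ∂Pr, ∀ B : Set E, MeasurableSet B → B.Nonempty →
      ∃ x ∈ B, IsMaxOn (H ω) B x)
    (hH : ∀ φ : E → ℝ≥0∞, Measurable φ →
      NullMeasurableSet {ω | ∀ x, φ x * EReal.exp (H ω x) ≤ 1} Pr ∧
      Pr {ω | ∀ x, φ x * EReal.exp (H ω x) ≤ 1} = expNeg (∫⁻ x, φ x ∂P)) :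
    IsGumbelProcess H P Pr := by
  classical
  have joint : ∀ (m : ℕ) (A : Fin m → Set E), (∀ i, MeasurableSet (A i)) →
      (∀ i j, i ≠ j → Disjoint (A i) (A j)) → ∀ t : Fin m → EReal,
      NullMeasurableSet {ω | ∀ i, maxOver (H ω) (A i) ≤ t i} Pr ∧
      Pr {ω | ∀ i, maxOver (H ω) (A i) ≤ t i} = ∏ i, expNeg (EReal.exp (-t i) * P (A i)) := by
    intro m A hA hdisj t
    -- Threshold `t i` on `A i`; the value 0 off the union imposes no constraint there.
    let φ : E → ℝ≥0∞ := fun x => ∑ i, (A i).indicator (fun _ => EReal.exp (-t i)) x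
    have hφ : Measurable φ :=
      Finset.measurable_fun_sum _ fun i _ => measurable_const.indicator (hA i)
    have hφA : ∀ i, ∀ x ∈ A i, φ x = EReal.exp (-t i) := by
      intro i x hx
      simp only [φ]
      rw [Finset.sum_eq_single i, Set.indicator_of_mem hx]
      · intro j _ hj
        exact Set.indicator_of_notMem (fun h => (hdisj j i hj).le_bot ⟨h, hx⟩) _
      · simp
    have hset : {ω | ∀ i, maxOver (H ω) (A i) ≤ t i} =
        {ω | ∀ x, φ x * EReal.exp (H ω x) ≤ 1} := by
      ext ω
      simp only [Set.mem_ofPred_eq, maxOver_le_iff]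
      simp only [← exp_neg_mul_exp_le_one_iff (t _)]
      constructor
      · intro h x
        by_cases hx : ∃ i, x ∈ A i
        · obtain ⟨i, hi⟩ := hx
          rw [hφA i x hi]
          exact h i x hi
        · push Not at hx
          have : φ x = 0 := Finset.sum_eq_zero fun i _ => Set.indicator_of_notMem (hx i) _
          simp [this]
      · intro h i x hx
        rw [← hφA i x hx]
        exact h x
    rw [hset]
    refine ⟨(hH φ hφ).1, ?_⟩
    rw [(hH φ hφ).2, ← expNeg_sum,
      lintegral_finsetSum _ fun i _ => measurable_const.indicator (hA i)]
    simp_rw [lintegral_indicator_const (hA _)]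
  have single : ∀ B : Set E, MeasurableSet B → ∀ t : EReal,
      NullMeasurableSet {ω | maxOver (H ω) B ≤ t} Pr ∧
      Pr {ω | maxOver (H ω) B ≤ t} = expNeg (EReal.exp (-t) * P B) := by
    intro B hB t
    simpa using joint 1 (fun _ => B) (fun _ => hB)
      (fun i j hij => absurd (Subsingleton.elim i j) hij) (fun _ => t)
  have hmeas : ∀ B : Set E, MeasurableSet B → AEMeasurable (fun ω => maxOver (H ω) B) Pr :=
    fun B hB => aemeasurable_of_nullMeasurableSet_le fun t => (single B hB t).1
  exact
    { ne_top := ne_top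
      exists_max := exists_max
      isGumbel := fun B hB =>
        isGumbel_of_measure_le (measure_ne_top P B) (hmeas B hB) fun t => (single B hB t).2
      indep := fun m A hA hdisj => iIndepFun_of_measure_le (fun i => hmeas _ (hA i)) fun t => by
        rw [(joint m A hA hdisj t).2]
        simp_rw [(single _ (hA _) _).2] }

/-! ### Finitely many points above each level, and existence of maxima -/

/-- Some cell of some partition separates the points; in every later partition it is a union of
cells, so the points cannot share one. -/
lemma eventually_countablePartitionSet_ne [MeasurableSpace.CountablyGenerated E]
    [MeasurableSpace.SeparatesPoints E] {x y : E} (hxy : x ≠ y) :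
    ∀ᶠ k in Filter.atTop,
      MeasurableSpace.countablePartitionSet k x ≠ MeasurableSpace.countablePartitionSet k y := by
  have hsep : ∃ n, ∃ t ∈ MeasurableSpace.countablePartition E n, ¬ (x ∈ t ↔ y ∈ t) := by
    by_contra! h
    refine hxy (@MeasurableSpace.separating_of_generateFrom E
      (⋃ n, MeasurableSpace.countablePartition E n) ?_ x y ?_)
    · rwa [MeasurableSpace.generateFrom_iUnion_countablePartition]
    · intro s hs
      obtain ⟨n, hn⟩ := Set.mem_iUnion.1 hs
      exact h n s hn
  obtain ⟨n, t, ht, hne⟩ := hsep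
  filter_upwards [Filter.eventually_ge_atTop n] with k hk heq
  have hmono := monotone_nat_of_le_succ
    (MeasurableSpace.generateFrom_countablePartition_le_succ E)
  have htk := hmono hk t (MeasurableSpace.measurableSet_generateFrom ht)
  obtain ⟨S, hS, rfl⟩ :=
    (MeasurableSpace.measurableSet_generateFrom_countablePartition_iff k t).1 htk
  have aux : ∀ {x y : E}, MeasurableSpace.countablePartitionSet k x =
      MeasurableSpace.countablePartitionSet k y → x ∈ ⋃₀ (S : Set (Set E)) →
      y ∈ ⋃₀ (S : Set (Set E)) := by
    rintro x y heq ⟨u, hu, hxu⟩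
    refine ⟨u, hu, ?_⟩
    rw [← MeasurableSpace.countablePartitionSet_of_mem (hS hu) hxu, heq]
    exact MeasurableSpace.mem_countablePartitionSet k y
  exact hne ⟨aux heq, aux heq.symm⟩

/-- Almost surely, a Gumbel process exceeds a given real level at finitely many points only. -/
lemma IsGumbelProcess.ae_finite_setOf_lt [MeasurableSpace.CountablyGenerated E]
    [MeasurableSpace.SeparatesPoints E] {G : Ω → E → EReal} {Q : Measure E} [IsFiniteMeasure Q]
    (hG : IsGumbelProcess G Q Pr) (t : ℝ) : ∀ᵐ ω ∂Pr, {x | (t : EReal) < G ω x}.Finite := by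
  classical
  let C : ℕ → Finset (Set E) := fun k => (MeasurableSpace.finite_countablePartition E k).toFinset
  have hCmem : ∀ {k s}, s ∈ C k ↔ s ∈ MeasurableSpace.countablePartition E k := by
    simp [C]
  have hCm : ∀ {k s}, s ∈ C k → MeasurableSet s := fun h =>
    MeasurableSpace.measurableSet_countablePartition _ (hCmem.1 h)
  let D : Set E → Set Ω := fun s => {ω | maxOver (G ω) s ≤ t}ᶜ
  have hD : ∀ s, MeasurableSet s → NullMeasurableSet (D s) Pr := fun s hs =>
    ((hG.isGumbel s hs).1.nullMeasurableSet_preimage measurableSet_Iic).compl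
  -- `N k` counts the cells of the `k`-th partition where the maximum exceeds `t`. Its mean is
  -- bounded uniformly in `k` by `1 - e⁻ᵃ ≤ a`, so by Fatou its liminf is almost surely finite.
  let N : ℕ → Ω → ℝ≥0∞ := fun k ω => ∑ s ∈ C k, (D s).indicator (fun _ => 1) ω
  have hNm : ∀ k, AEMeasurable (N k) Pr := fun k =>
    Finset.aemeasurable_fun_sum _ fun s hs => aemeasurable_const.indicator₀ (hD s (hCm hs))
  have hN : ∀ k, ∫⁻ ω, N k ω ∂Pr ≤ EReal.exp (-(t : EReal)) * Q Set.univ := by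
    intro k
    simp only [N]
    rw [lintegral_finsetSum' _ fun s hs => aemeasurable_const.indicator₀ (hD s (hCm hs))]
    calc ∑ s ∈ C k, ∫⁻ ω, (D s).indicator (fun _ => 1) ω ∂Pr
        ≤ ∑ s ∈ C k, EReal.exp (-(t : EReal)) * Q s := by
          refine Finset.sum_le_sum fun s hs => ?_
          rw [lintegral_indicator_const₀ (hD s (hCm hs)), one_mul, prob_compl_eq_one_sub₀
            (NullMeasurableSet.compl_iff.1 (hD s (hCm hs))), (hG.isGumbel s (hCm hs)).measure_le]
          exact one_sub_expNeg_le _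
      _ = EReal.exp (-(t : EReal)) * Q (⋃ s ∈ C k, s) := by
          rw [← Finset.mul_sum, measure_biUnion_finset _ fun s hs => hCm hs]
          intro s hs u hu hsu
          exact MeasurableSpace.disjoint_countablePartition (hCmem.1 hs) (hCmem.1 hu) hsu
      _ ≤ _ := by gcongr; exact Set.subset_univ _
  have hlim : ∫⁻ ω, Filter.liminf (fun k => N k ω) Filter.atTop ∂Pr ≠ ⊤ := by
    refine ne_top_of_le_ne_top (b := EReal.exp (-(t : EReal)) * Q Set.univ) ?_ ?_
    · rw [← EReal.coe_neg, EReal.exp_coe]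
      exact ENNReal.mul_ne_top ENNReal.ofReal_ne_top (measure_ne_top _ _)
    · refine (lintegral_liminf_le' hNm).trans
        (Filter.liminf_le_of_le (by isBoundedDefault) fun b hb => ?_)
      · obtain ⟨k, hk⟩ := hb.exists
        exact hk.trans (hN k)
  have hNliminf : AEMeasurable (fun ω => Filter.liminf (fun k => N k ω) Filter.atTop) Pr := by
    simp_rw [Filter.liminf_eq_iSup_iInf_of_nat']
    exact AEMeasurable.iSup fun n => AEMeasurable.iInf fun i => hNm _
  filter_upwards [ae_lt_top' hNliminf hlim] with ω hω
  by_contra hinf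
  refine hω.ne (ENNReal.eq_top_of_forall_nnreal_le fun r => ?_)
  -- Any `m` points above the level eventually lie in `m` distinct cells, so `N k ≥ m` eventually.
  obtain ⟨m, hm⟩ := exists_nat_ge r
  obtain ⟨F, hF, hFm⟩ := Set.Infinite.exists_subset_card_eq hinf m
  refine Filter.le_liminf_of_le (by isBoundedDefault) ?_
  have hinj : ∀ᶠ k in Filter.atTop, ∀ p ∈ F ×ˢ F, p.1 ≠ p.2 →
      MeasurableSpace.countablePartitionSet k p.1 ≠
        MeasurableSpace.countablePartitionSet k p.2 := by
    rw [Filter.eventually_all_finset]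
    intro p _
    by_cases hp : p.1 = p.2
    · simp [hp]
    · filter_upwards [eventually_countablePartitionSet_ne hp] with k hk _ using hk
  filter_upwards [hinj] with k hk
  have hinj' : Set.InjOn (MeasurableSpace.countablePartitionSet k) (F : Set E) := by
    intro x hx y hy hxy
    by_contra hne
    exact hk (x, y) (Finset.mk_mem_product hx hy) hne hxy
  calc (r : ℝ≥0∞) ≤ (m : ℝ≥0∞) := by exact_mod_cast hm
    _ = ∑ s ∈ F.image (MeasurableSpace.countablePartitionSet k), (1 : ℝ≥0∞) := by
        rw [Finset.sum_const, Finset.card_image_of_injOn hinj', hFm]; simp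
    _ = ∑ s ∈ F.image (MeasurableSpace.countablePartitionSet k), (D s).indicator (fun _ => 1) ω := by
        refine Finset.sum_congr rfl fun s hs => ?_
        obtain ⟨x, hx, rfl⟩ := Finset.mem_image.1 hs
        rw [Set.indicator_of_mem]
        simp only [D, Set.mem_compl_iff, Set.mem_ofPred_eq, not_le]
        exact lt_of_lt_of_le (hF hx) (le_maxOver (MeasurableSpace.mem_countablePartitionSet k x))
    _ ≤ N k ω := by
        refine Finset.sum_le_sum_of_subset fun s hs => ?_
        obtain ⟨x, hx, rfl⟩ := Finset.mem_image.1 hs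
        exact hCmem.2 (MeasurableSpace.countablePartitionSet_mem k x)

lemma IsGumbelProcess.ae_finite_setOf_le_exp [MeasurableSpace.CountablyGenerated E]
    [MeasurableSpace.SeparatesPoints E] {G : Ω → E → EReal} {Q : Measure E} [IsFiniteMeasure Q]
    (hG : IsGumbelProcess G Q Pr) :
    ∀ᵐ ω ∂Pr, ∀ a : ℝ≥0∞, a ≠ 0 → {x | a ≤ EReal.exp (G ω x)}.Finite := by
  filter_upwards [ae_all_iff.2 fun n : ℕ => hG.ae_finite_setOf_lt (-n : ℝ)] with ω hω a ha
  obtain ⟨t, ht, hta⟩ := EReal.lt_iff_exists_real_btwn.1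
    (ENNReal.bot_lt_log_iff.2 (pos_iff_ne_zero.2 ha))
  obtain ⟨n, hn⟩ := exists_nat_ge (-t)
  refine (hω n).subset fun x hx => ?_
  have h1 : ENNReal.log a ≤ G ω x := by
    simpa using ENNReal.log_monotone hx
  refine lt_of_le_of_lt ?_ (hta.trans_le h1)
  exact_mod_cast neg_le.1 hn

/-- The Gumbel-Max trick: multiplying the measure by a bounded density adds its logarithm to the
process. -/
theorem IsGumbelProcess.log_add [MeasurableSpace.CountablyGenerated E]
    [MeasurableSpace.SeparatesPoints E] {G : Ω → E → EReal} {Q : Measure E} [IsFiniteMeasure Q]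
    (hG : IsGumbelProcess G Q Pr) {r : E → ℝ≥0} (hr : Measurable r) {M : ℝ≥0}
    (hM : ∀ x, r x ≤ M) :
    IsGumbelProcess (fun ω x => ENNReal.log (r x) + G ω x)
      (Q.withDensity fun x => (r x : ℝ≥0∞)) Pr := by
  have hexp : ∀ ω x, EReal.exp (ENNReal.log (r x) + G ω x) = r x * EReal.exp (G ω x) :=
    fun ω x => by rw [EReal.exp_add, ENNReal.exp_log]
  have : IsFiniteMeasure (Q.withDensity fun x => (r x : ℝ≥0∞)) := by
    refine isFiniteMeasure_withDensity (ne_top_of_le_ne_top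
      (b := (M : ℝ≥0∞) * Q Set.univ) (ENNReal.mul_ne_top ENNReal.coe_ne_top (measure_ne_top _ _)) ?_)
    rw [← lintegral_const]
    exact lintegral_mono fun x => ENNReal.coe_le_coe.2 (hM x)
  refine isGumbelProcess_of_measure (fun ω x h => ?_) ?_ fun φ hφ => ?_
  · rw [← EReal.exp_eq_top_iff, hexp] at h
    refine ENNReal.mul_ne_top ENNReal.coe_ne_top ?_ h
    rw [ne_eq, EReal.exp_eq_top_iff]
    exact hG.ne_top ω x
  · filter_upwards [hG.ae_finite_setOf_le_exp] with ω hω B _ ⟨x₁, hx₁⟩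
    let H : E → EReal := fun x => ENNReal.log (r x) + G ω x
    by_cases hbot : ∀ x ∈ B, H x = ⊥
    · exact ⟨x₁, hx₁, fun x hx => (hbot x hx).le.trans bot_le⟩
    push Not at hbot
    obtain ⟨x₀, hx₀, h₀⟩ := hbot
    have hfin : (B ∩ {x | H x₀ ≤ H x}).Finite := by
      -- Since `exp H ≤ M * exp G`, a point at least as good as `x₀` satisfies `exp G ≥ exp (H x₀) /
      -- M`, a nonzero level.
      refine (hω (EReal.exp (H x₀) / M) ?_).subset fun x hx => ?_
      · refine ENNReal.div_ne_zero.2 ⟨?_, ENNReal.coe_ne_top⟩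
        rwa [ne_eq, EReal.exp_eq_zero_iff]
      · refine ENNReal.div_le_of_le_mul' ((EReal.exp_monotone hx.2).trans ?_)
        rw [hexp]
        gcongr
        exact hM x
    obtain ⟨x, hx, hmax⟩ := Set.exists_max_image _ H hfin ⟨x₀, hx₀, le_refl (H x₀)⟩
    refine ⟨x, hx.1, fun y hy => ?_⟩
    rcases le_total (H x₀) (H y) with h | h
    · exact hmax y ⟨hy, h⟩
    · exact h.trans hx.2
  · simp_rw [hexp, ← mul_assoc]
    rw [lintegral_withDensity_eq_lintegral_mul _ hr.coe_nnreal_ennreal hφ]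
    have := hG.measure_forall_mul_exp_le_one (hφ.mul hr.coe_nnreal_ennreal)
    simpa [mul_comm] using this

end GumbelProcess

/-! ### Exponential integrals -/

lemma expMeasure_Ici {p : ℝ} (hp : 0 < p) (u : ℝ) :
    expMeasure p (Set.Ici u) = ENNReal.ofReal (Real.exp (-(p * max u 0))) := by
  have : IsProbabilityMeasure (expMeasure p) := isProbabilityMeasure_expMeasure hp
  have hdens : expMeasure p = volume.withDensity (exponentialPDF p) := rfl
  have : NullSingletonClass (expMeasure p) := by rw [hdens]; infer_instance
  rw [← Set.compl_Iio, prob_compl_eq_one_sub measurableSet_Iio, measure_congr Iio_ae_eq_Iic, hdens,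
    withDensity_apply _ measurableSet_Iic, lintegral_exponentialPDF_eq_antiDeriv hp,
    ← ENNReal.ofReal_one, ← ENNReal.ofReal_sub]
  · split_ifs with h
    · simp [max_eq_left h]
    · simp [max_eq_right (not_le.1 h).le]
  · split_ifs with h
    · simpa using mul_nonneg hp.le h
    · exact le_rfl

/-- The integrand times the density of rate `p` is `p / (p + q)` times the density of rate `p + q`.
-/
lemma lintegral_exp_neg_mul_expMeasure {p q : ℝ} (hp : 0 < p) (hq : 0 ≤ q) :
    ∫⁻ u, ENNReal.ofReal (Real.exp (-(q * u))) ∂(expMeasure p) = ENNReal.ofReal (p / (p + q)) := by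
  have hpq : 0 < p + q := by positivity
  have hdens : expMeasure p = volume.withDensity (exponentialPDF p) := rfl
  have hmeas : Measurable (exponentialPDF p) := (measurable_exponentialPDFReal p).ennreal_ofReal
  rw [hdens, lintegral_withDensity_eq_lintegral_mul _ hmeas (by fun_prop)]
  have : ∀ u, (exponentialPDF p * fun u => ENNReal.ofReal (Real.exp (-(q * u)))) u
      = ENNReal.ofReal (p / (p + q)) * exponentialPDF (p + q) u := by
    intro u
    simp only [Pi.mul_apply, exponentialPDF_eq]
    split_ifs with hu
    · rw [← ENNReal.ofReal_mul (by positivity), ← ENNReal.ofReal_mul (by positivity), mul_assoc,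
        ← Real.exp_add]
      congr 1
      rw [← mul_assoc, div_mul_cancel₀ _ hpq.ne']
      congr 2
      ring
    · simp
  simp_rw [this]
  rw [lintegral_const_mul' _ _ ENNReal.ofReal_ne_top, lintegral_exponentialPDF_eq_one hpq, mul_one]

/-! ### The race between two independent Gumbel variables -/

section Race

variable {Ω : Type*} [MeasurableSpace Ω] {Pr : Measure Ω} [IsProbabilityMeasure Pr]
  {X Y : Ω → EReal} {p q : ℝ≥0∞}

lemma IsGumbel.ae_ne_bot (hp0 : p ≠ 0) (hX : IsGumbel X (ENNReal.log p) Pr) :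
    ∀ᵐ ω ∂Pr, X ω ≠ ⊥ := by
  have := hX.measure_le ⊥
  rw [EReal.neg_bot, EReal.exp_top, ENNReal.top_mul hp0, expNeg_top] at this
  rw [ae_iff]
  simpa using this

omit [IsProbabilityMeasure Pr] in
lemma IsGumbel.ae_eq_bot (hX : IsGumbel X (ENNReal.log 0) Pr) : ∀ᵐ ω ∂Pr, X ω = ⊥ := by
  rcases hX.2 with ⟨_, h⟩ | ⟨a, ha, _⟩
  · exact h
  · simp at ha

/-- If `X` is Gumbel with location `log p`, then `e⁻ˣ` is exponential with rate `p`. -/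
lemma IsGumbel.map_exp_neg (hp0 : p ≠ 0) (hp : p ≠ ⊤) (hX : IsGumbel X (ENNReal.log p) Pr) :
    Pr.map (fun ω => (EReal.exp (-X ω)).toReal) = expMeasure p.toReal := by
  have hp' : 0 < p.toReal := ENNReal.toReal_pos hp0 hp
  have hU : AEMeasurable (fun ω => (EReal.exp (-X ω)).toReal) Pr :=
    (EReal.measurable_exp.comp_aemeasurable hX.1.neg).ennreal_toReal
  refine Measure.ext_of_Ici _ _ fun u => ?_
  rw [Measure.map_apply_of_aemeasurable hU measurableSet_Ici, expMeasure_Ici hp']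
  have h1 := hX.measure_le (-ENNReal.log (ENNReal.ofReal u))
  rw [neg_neg, ENNReal.exp_log, expNeg_of_ne_top (ENNReal.mul_ne_top ENNReal.ofReal_ne_top hp),
    ENNReal.toReal_mul, ENNReal.toReal_ofReal', mul_comm] at h1
  rw [← h1]
  refine measure_congr (Filter.eventuallyEq_set.2 ?_)
  filter_upwards [hX.ae_ne_bot hp0] with ω hω
  have hne : EReal.exp (-X ω) ≠ ⊤ := by
    rw [ne_eq, EReal.exp_eq_top_iff, EReal.neg_eq_top_iff]; exact hω
  simp only [Set.mem_preimage, Set.mem_Ici]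
  rw [← ENNReal.ofReal_le_iff_le_toReal hne, EReal.le_neg, ← EReal.exp_le_exp_iff,
    ENNReal.exp_log]

/-- Given `X`, the event has probability `exp (-q U)` with `U = exp (-X)`, exponential of rate `p`;
then integrate over `U`. -/
lemma IsGumbel.measure_le_of_indepFun (hp0 : p ≠ 0) (hp : p ≠ ⊤) (hq : q ≠ ⊤)
    (hX : IsGumbel X (ENNReal.log p) Pr) (hY : IsGumbel Y (ENNReal.log q) Pr)
    (hXY : IndepFun X Y Pr) : Pr {ω | Y ω ≤ X ω} = p / (p + q) := by
  have hU : AEMeasurable (fun ω => (EReal.exp (-X ω)).toReal) Pr :=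
    (EReal.measurable_exp.comp_aemeasurable hX.1.neg).ennreal_toReal
  have hS : MeasurableSet {z : EReal × EReal | z.2 ≤ z.1} :=
    measurableSet_le measurable_snd measurable_fst
  have h1 : Pr {ω | Y ω ≤ X ω} = ∫⁻ ω, expNeg (EReal.exp (-X ω) * q) ∂Pr := by
    have hmap : Pr {ω | Y ω ≤ X ω} = (Pr.map fun ω => (X ω, Y ω)) {z : EReal × EReal | z.2 ≤ z.1} := by
      rw [Measure.map_apply_of_aemeasurable (hX.1.prodMk hY.1) hS]; rfl
    have : IsProbabilityMeasure (Pr.map Y) := Measure.isProbabilityMeasure_map hY.1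
    rw [hmap, hXY.map_prod_eq_prod_map_map hX.1 hY.1, Measure.prod_apply hS]
    have h2 : ∀ x : EReal, Pr.map Y (Prod.mk x ⁻¹' {z : EReal × EReal | z.2 ≤ z.1})
        = expNeg (EReal.exp (-x) * q) := fun x => by
      rw [← hY.measure_le, Measure.map_apply_of_aemeasurable hY.1 (measurable_prodMk_left hS)]
      rfl
    simp_rw [h2]
    refine lintegral_map' ?_ hX.1
    exact (continuous_expNeg.measurable.comp
      ((EReal.measurable_exp.comp measurable_neg).mul_const q)).aemeasurable
  have h2 : ∀ᵐ ω ∂Pr, expNeg (EReal.exp (-X ω) * q) =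
      ENNReal.ofReal (Real.exp (-(q.toReal * (EReal.exp (-X ω)).toReal))) := by
    filter_upwards [hX.ae_ne_bot hp0] with ω hω
    have hne : EReal.exp (-X ω) ≠ ⊤ := by
      rw [ne_eq, EReal.exp_eq_top_iff, EReal.neg_eq_top_iff]; exact hω
    rw [expNeg_of_ne_top (ENNReal.mul_ne_top hne hq), ENNReal.toReal_mul, mul_comm]
  rw [h1, lintegral_congr_ae h2,
    ← lintegral_map' (f := fun u : ℝ => ENNReal.ofReal (Real.exp (-(q.toReal * u))))
      (Measurable.aemeasurable (by fun_prop)) hU,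
    hX.map_exp_neg hp0 hp,
    lintegral_exp_neg_mul_expMeasure (ENNReal.toReal_pos hp0 hp) ENNReal.toReal_nonneg,
    ← ENNReal.toReal_add hp hq, ENNReal.ofReal_div_of_pos, ENNReal.ofReal_toReal hp,
    ENNReal.ofReal_toReal (ENNReal.add_ne_top.2 ⟨hp, hq⟩)]
  exact ENNReal.toReal_pos (by simp [hp0]) (ENNReal.add_ne_top.2 ⟨hp, hq⟩)

/-- For nonzero `p`, `q`, the events `X ≤ Y` and `Y ≤ X` cover everything and their probabilities
add up to 1, so their intersection is null. -/
lemma IsGumbel.ae_ne_of_indepFun (hp : p ≠ ⊤) (hq : q ≠ ⊤)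
    (hX : IsGumbel X (ENNReal.log p) Pr) (hY : IsGumbel Y (ENNReal.log q) Pr)
    (hXY : IndepFun X Y Pr) : ∀ᵐ ω ∂Pr, X ω = Y ω → X ω = ⊥ := by
  rcases eq_or_ne p 0 with rfl | hp0
  · filter_upwards [hX.ae_eq_bot] with ω hω _ using hω
  rcases eq_or_ne q 0 with rfl | hq0
  · filter_upwards [hY.ae_eq_bot] with ω hω h using h.trans hω
  have h1 := hX.measure_le_of_indepFun hp0 hp hq hY hXY
  have h2 := hY.measure_le_of_indepFun hq0 hq hp hX hXY.symm
  have h3 := measure_union_add_inter₀ (μ := Pr) {ω | X ω ≤ Y ω}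
    (nullMeasurableSet_le hY.1 hX.1)
  have hu : {ω | X ω ≤ Y ω} ∪ {ω | Y ω ≤ X ω} = Set.univ := by
    ext ω; simpa using le_total _ _
  rw [hu, measure_univ, h1, h2, add_comm q p, ENNReal.div_add_div_same, add_comm q p,
    ENNReal.div_self (by simp [hp0]) (ENNReal.add_ne_top.2 ⟨hp, hq⟩)] at h3
  have h4 : Pr ({ω | X ω ≤ Y ω} ∩ {ω | Y ω ≤ X ω}) = 0 :=
    (ENNReal.add_right_inj ENNReal.one_ne_top).1 (h3.trans (add_zero 1).symm)
  filter_upwards [measure_eq_zero_iff_ae_notMem.1 h4] with ω hω h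
  exact absurd ⟨h.le, h.ge⟩ hω

end Race

/-! ### Uniqueness and law of the maximizer -/

section Argmax

variable {Ω : Type*} [MeasurableSpace Ω] {Pr : Measure Ω} [IsProbabilityMeasure Pr]
  {E : Type*} [MeasurableSpace E] {H : Ω → E → EReal} {P : Measure E} [IsFiniteMeasure P]

omit [IsProbabilityMeasure Pr] [IsFiniteMeasure P] in
lemma IsGumbelProcess.indepFun_compl (hH : IsGumbelProcess H P Pr) {B : Set E}
    (hB : MeasurableSet B) :
    IndepFun (fun ω => maxOver (H ω) B) (fun ω => maxOver (H ω) Bᶜ) Pr := by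
  have := hH.indep 2 ![B, Bᶜ] (fun i => by fin_cases i <;> simp [hB]) (fun i j hij => by
    fin_cases i <;> fin_cases j <;> simp_all [disjoint_compl_right, disjoint_compl_left])
  exact this.indepFun (i := 0) (j := 1) (by simp)

/-- Two maximizers would be separated by some `B` in a countable family, giving a tie between `B`
and `Bᶜ` at a value other than `⊥`. Countability leaves a single null set. -/
lemma IsGumbelProcess.ae_existsUnique_isMaxOn [MeasurableSpace.CountablySeparated E]
    (hH : IsGumbelProcess H P Pr) (hP0 : P ≠ 0) :
    ∀ᵐ ω ∂Pr, ∃! x, IsMaxOn (H ω) Set.univ x := by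
  obtain ⟨S, hSc, hSm, hS⟩ := exists_countable_separating E MeasurableSet Set.univ
  have h1 : ∀ᵐ ω ∂Pr, ∀ B ∈ S,
      maxOver (H ω) B = maxOver (H ω) Bᶜ → maxOver (H ω) B = ⊥ := by
    rw [ae_ball_iff hSc]
    intro B hB
    exact (hH.isGumbel B (hSm B hB)).ae_ne_of_indepFun (measure_ne_top _ _) (measure_ne_top _ _)
      (hH.isGumbel _ (hSm B hB).compl) (hH.indepFun_compl (hSm B hB))
  have h2 := (hH.isGumbel Set.univ MeasurableSet.univ).ae_ne_bot
    (Measure.measure_univ_ne_zero.2 hP0)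
  have hne : Nonempty E := by
    by_contra h
    rw [not_nonempty_iff] at h
    exact hP0 (Measure.eq_zero_of_isEmpty P)
  filter_upwards [h1, h2, hH.exists_max] with ω h1 h2 h3
  obtain ⟨x, _, hx⟩ := h3 Set.univ MeasurableSet.univ Set.univ_nonempty
  refine ⟨x, hx, fun y hy => ?_⟩
  rw [maxOver_eq_of_isMaxOn hx (Set.mem_univ x)] at h2
  have hxy : H ω y = H ω x := le_antisymm (hx (Set.mem_univ y)) (hy (Set.mem_univ x))
  have key : ∀ {B : Set E}, (maxOver (H ω) B = maxOver (H ω) Bᶜ → maxOver (H ω) B = ⊥) →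
      ∀ {a b : E}, IsMaxOn (H ω) Set.univ a → IsMaxOn (H ω) Set.univ b → H ω a ≠ ⊥ →
      a ∈ B → b ∈ B := by
    intro B hB a b ha hb hab haB
    by_contra hbB
    have ea := maxOver_eq_of_isMaxOn (ha.on_subset (Set.subset_univ B)) haB
    have eb := maxOver_eq_of_isMaxOn (hb.on_subset (Set.subset_univ Bᶜ)) hbB
    refine hab (ea ▸ hB ?_)
    rw [ea, eb]
    exact le_antisymm (hb (Set.mem_univ a)) (ha (Set.mem_univ b))
  exact hS y (Set.mem_univ y) x (Set.mem_univ x) fun B hB =>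
    ⟨key (h1 B hB) hy hx (hxy ▸ h2), key (h1 B hB) hx hy h2⟩

lemma IsGumbelProcess.hasLaw_argmax [MeasurableSpace.CountablyGenerated E]
    [MeasurableSpace.SeparatesPoints E] (hH : IsGumbelProcess H P Pr) (hP0 : P ≠ 0) {X : Ω → E}
    (hX : ∀ᵐ ω ∂Pr, IsMaxOn (H ω) Set.univ (X ω)) :
    HasLaw X ((P Set.univ)⁻¹ • P) Pr := by
  have h2 := (hH.isGumbel Set.univ MeasurableSet.univ).ae_ne_bot
    (Measure.measure_univ_ne_zero.2 hP0)
  have hpre : ∀ B : Set E, MeasurableSet B →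
      -- This also supplies the measurability of `X`, which is not assumed. The clause `≠ ⊥`
      -- excludes the tie left open by `ae_ne_of_indepFun` and makes the event null when `P B = 0`.
      X ⁻¹' B =ᵐ[Pr] {ω | maxOver (H ω) Bᶜ ≤ maxOver (H ω) B ∧ maxOver (H ω) B ≠ ⊥} := by
    intro B hB
    refine Filter.eventuallyEq_set.2 ?_
    filter_upwards [hX, h2, (hH.isGumbel B hB).ae_ne_of_indepFun (measure_ne_top _ _)
      (measure_ne_top _ _) (hH.isGumbel _ hB.compl) (hH.indepFun_compl hB)] with ω hx h2 h3
    rw [maxOver_eq_of_isMaxOn hx (Set.mem_univ _)] at h2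
    have hle : ∀ C : Set E, maxOver (H ω) C ≤ H ω (X ω) := fun C =>
      (maxOver_le_iff _ _ _).2 fun y _ => hx (Set.mem_univ y)
    simp only [Set.mem_preimage]
    constructor
    · intro h
      rw [maxOver_eq_of_isMaxOn (hx.on_subset (Set.subset_univ B)) h]
      exact ⟨hle _, h2⟩
    · rintro ⟨h, hbot⟩
      by_contra hxB
      have e := maxOver_eq_of_isMaxOn (hx.on_subset (Set.subset_univ Bᶜ)) hxB
      exact hbot (h3 (le_antisymm (e ▸ hle B) h))
  have hXm : AEMeasurable X Pr := NullMeasurable.aemeasurable fun B hB =>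
    NullMeasurableSet.congr
      ((nullMeasurableSet_le (hH.isGumbel _ hB.compl).1 (hH.isGumbel _ hB).1).inter
        ((hH.isGumbel _ hB).1.nullMeasurableSet_preimage (measurableSet_singleton ⊥)).compl)
      (hpre B hB).symm
  refine ⟨hXm, Measure.ext fun B hB => ?_⟩
  rw [Measure.map_apply_of_aemeasurable hXm hB, measure_congr (hpre B hB), Measure.smul_apply,
    smul_eq_mul]
  rcases eq_or_ne (P B) 0 with h0 | h0
  · rw [h0, mul_zero, measure_eq_zero_iff_ae_notMem]
    have := hH.isGumbel B hB
    rw [h0] at this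
    filter_upwards [this.ae_eq_bot] with ω hω h
    exact h.2 hω
  · rw [mul_comm, ← div_eq_mul_inv, ← measure_add_measure_compl hB,
      ← (hH.isGumbel B hB).measure_le_of_indepFun h0 (measure_ne_top _ _) (measure_ne_top _ _)
        (hH.isGumbel _ hB.compl) (hH.indepFun_compl hB)]
    refine measure_congr (Filter.eventuallyEq_set.2 ?_)
    filter_upwards [(hH.isGumbel B hB).ae_ne_bot h0] with ω hω
    simp [hω]

end Argmax

/-- Off the support, division by zero gives ratio 0, and `log 0 + G x = ⊥` in the extended reals. -/
lemma gumbelPerturb_eq_log_add {E : Type*} {f g : E → ℝ≥0}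
    (hsupp : Function.support f = Function.support g) {G : E → EReal} (x : E) :
    gumbelPerturb f g G x = ENNReal.log ((f x / g x : ℝ≥0) : ℝ≥0∞) + G x := by
  unfold gumbelPerturb
  split_ifs with h
  · have hg : g x ≠ 0 := h
    have hf : f x ≠ 0 := by rw [← hsupp] at h; exact h
    rw [ENNReal.log_of_nnreal (div_ne_zero hf hg), NNReal.coe_div, Real.log_div] <;>
      exact_mod_cast ‹_›
  · have hg : g x = 0 := by simpa using h
    simp [hg]

theorem mainTheorem5 {n : ℕ} {Ω : Type*} [MeasurableSpace Ω] (Pr : Measure Ω)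
    [IsProbabilityMeasure Pr]
    (μ Q P : Measure (EuclideanSpace ℝ (Fin n)))
    [IsFiniteMeasure Q] [IsFiniteMeasure P] (hQ0 : Q ≠ 0) (hP0 : P ≠ 0)
    (f g : EuclideanSpace ℝ (Fin n) → ℝ≥0) (hf : Measurable f) (hg : Measurable g)
    (hQ : Q = μ.withDensity (fun x => (g x : ℝ≥0∞)))
    (hP : P = μ.withDensity (fun x => (f x : ℝ≥0∞)))
    (hsupp : Function.support f = Function.support g)
    (hbdd : ∃ M : ℝ≥0, ∀ x ∈ Function.support g, f x / g x ≤ M)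
    (G : Ω → EuclideanSpace ℝ (Fin n) → EReal) (hG : IsGumbelProcess G Q Pr) :
    IsGumbelProcess (fun ω => gumbelPerturb f g (G ω)) P Pr ∧
    IsGumbel (fun ω => maxOver (gumbelPerturb f g (G ω)) Set.univ)
      (ENNReal.log (P Set.univ)) Pr ∧
    (∀ᵐ ω ∂Pr, ∃! x, IsMaxOn (gumbelPerturb f g (G ω)) Set.univ x) ∧
    ∀ X : Ω → EuclideanSpace ℝ (Fin n),
      (∀ᵐ ω ∂Pr, IsMaxOn (gumbelPerturb f g (G ω)) Set.univ (X ω)) →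
        HasLaw X ((P Set.univ)⁻¹ • P) Pr := by
  obtain ⟨M, hM⟩ := hbdd
  have hr : Measurable fun x => f x / g x := hf.div hg
  have hrM : ∀ x, f x / g x ≤ M := fun x => by
    by_cases hx : x ∈ Function.support g
    · exact hM x hx
    · have : g x = 0 := by simpa using hx
      simp [this]
  have hPQ : P = Q.withDensity fun x => ((f x / g x : ℝ≥0) : ℝ≥0∞) := by
    rw [hP, hQ, ← withDensity_mul _ hg.coe_nnreal_ennreal hr.coe_nnreal_ennreal]
    congr 1
    funext x
    rw [Pi.mul_apply, ← ENNReal.coe_mul]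
    congr 1
    -- Equality of supports enters here: where `g` vanishes, so does `f`, and `Q` misses no mass of
    -- `P`.
    by_cases hx : g x = 0
    · have : x ∉ Function.support f := by rw [hsupp]; simpa using hx
      simpa [hx] using this
    · rw [mul_div_cancel₀ _ hx]
  have hH : IsGumbelProcess (fun ω => gumbelPerturb f g (G ω)) P Pr := by
    have hfun : (fun ω => gumbelPerturb f g (G ω)) =
        fun ω x => ENNReal.log ((f x / g x : ℝ≥0) : ℝ≥0∞) + G ω x := by
      funext ω x
      exact gumbelPerturb_eq_log_add hsupp x
    rw [hfun, hPQ]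
    exact hG.log_add hr hrM
  exact ⟨hH, hH.isGumbel _ MeasurableSet.univ, hH.ae_existsUnique_isMaxOn hP0,
    fun X hX => hH.hasLaw_argmax hP0 hX⟩
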